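/- Let $\mathcal{A}=\{a_1,\dots,a_m\}$ be a finite set of actions, $m=|\mathcal{A}|$. A bandit with action set $\mathcal{A}$ is a stochastic process $\{R_t\}_{t\ge 1}$ with values in $\mathbb{R}^{\mathcal{A}}$; write $R_{t,a}$ for the entry of $R_t$ at $a\in\mathcal{A}$. Different bandits may live on different probability spaces. A history is a finite sequence of action-reward pairs, and a policy $\pi$ maps each history (measurably) to a probability distribution over $\mathcal{A}$. An agent that executes $\pi$ in the bandit $\{R_t\}_{t\ge1}$ generates histories $H^\pi_t$ as follows: $H^\pi_0$ is the empty history and, for each $t\ge 0$, the action $A^\pi_t$ satisfies $\mathbb{P}(A^\pi_t\in\cdot\mid H^\pi_t)=\pi(\cdot\mid H^\pi_t)$ and is independent of $\{R_s\}_{s\ge1}$ conditioned on $H^\pi_t$, and $H^\pi_{t+1}=(H^\pi_t,A^\pi_t,R_{t+1,A^\pi_t})$. Two bandits with the action set $\mathcal{A}$ are equivalent if, for all policies $\pi$ and all integers $T\ge 0$, the histories $H^\pi_T$ that $\pi$ generates in the two bandits are equal in distribution. A bandit is stationary if, for all integers $T\ge 0$, all sequences of actions $(b_k)_{k=1}^T$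 and all sequences of distinct timesteps $(t_k)_{k=1}^T$ and $(t'_k)_{k=1}^T$, the sequences $(R_{t_k,b_k})_{k=1}^T$ and $(R_{t'_k,b_k})_{k=1}^T$ are equal in distribution. A stationary bandit is strongly stationary if, for all integers $T\ge 1$, the sequences $(R_n)_{n=1}^T$ and $\big((R_{nm+1,a_1},R_{nm+2,a_2},\dots,R_{nm+m,a_m})\big)_{n=1}^T$ are equal in distribution. Then: 1. A bandit is stationary if and only if it is equivalent to a strongly stationary bandit. 2. Two strongly stationary bandits $\{R_t\}_{t\ge1}$ and $\{R'_t\}_{t\ge1}$ with the action set $\mathcal{A}$ are equivalent if and only if, for all integers $T\ge 1$, the sequences $\{R_t\}_{t=1}^T$ and $\{R'_t\}_{t=1}^T$ are equal in distribution. -/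

import Mathlib

open MeasureTheory ProbabilityTheory

universe u v

/-- A bandit with action set `A`: a stochastic process, on some probability space, with values in
`ℝ^A`. Time is shifted by one: `R t` is the vector of rewards at timestep `t + 1`, so that `R t ω a`
is the reward that an agent receives if it executes the action `a` at time `t = 0, 1, 2, …`. -/
structure Bandit (A : Type u) where
  /-- the sample space -/
  Ω : Type v
  [mΩ : MeasurableSpace Ω]
  /-- the probability measure -/
  P : Measure Ω
  [isProb : IsProbabilityMeasure P]
  /-- the reward vectors -/
  R : ℕ → Ω → (A → ℝ)
  measurable_R : ∀ t, Measurable (R t)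

attribute [instance] Bandit.mΩ Bandit.isProb

/-- Histories of length `t`: sequences of `t` action-reward pairs. -/
abbrev History (A : Type u) (t : ℕ) : Type u := Fin t → A × ℝ

/-- A policy maps each history, of any length `t`, to a probability distribution over the actions
(measurably in the history). -/
structure Policy (A : Type u) [MeasurableSpace A] where
  act : (t : ℕ) → Kernel (History A t) A
  isMarkov : ∀ t, IsMarkovKernel (act t)

namespace Bandit

section Interaction

variable {A : Type u} [MeasurableSpace A]

/-- The joint law of the sample point `ω` (hence of the whole reward process) and of the history
`H_t` generated by an agent that executes the policy `π`. The history `H_0` is empty. Given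
`(ω, H_t)`, the action `A_t` is drawn from `π(· | H_t)`; so `A_t` has conditional law `π(· | H_t)`
given `H_t` and is independent of all rewards conditioned on `H_t`. Then `H_{t+1}` is `H_t` followed
by the pair of `A_t` and the reward of the action `A_t` at timestep `t + 1`. -/
noncomputable def interactionLaw (B : Bandit.{u, v} A) (π : Policy A) :
    (t : ℕ) → Measure (B.Ω × History A t)
  | 0 => B.P.map (fun ω => (ω, Fin.elim0))
  | t + 1 =>
      (B.interactionLaw π t ⊗ₘ (π.act t).prodMkLeft B.Ω).map
        (fun x : (B.Ω × History A t) × A =>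
          (x.1.1, (Fin.snoc x.1.2 (x.2, B.R t x.1.1 x.2) : History A (t + 1))))

/-- The law of the history `H_T` generated by an agent that executes `π` in the bandit `B`. -/
noncomputable def historyLaw (B : Bandit.{u, v} A) (π : Policy A) (T : ℕ) : Measure (History A T) :=
  (B.interactionLaw π T).map Prod.snd

/-- Two bandits are equivalent if, for all policies `π` and all `T`, the histories `H_T` generated
by executing `π` in each of them are equal in distribution. -/
def Equivalent (B B' : Bandit.{u, v} A) : Prop :=
  ∀ (π : Policy A) (T : ℕ), B.historyLaw π T = B'.historyLaw π T

end Interaction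

/-- A bandit is stationary if the law of the rewards of an action sequence at distinct timesteps
does not depend on the timesteps. -/
def IsStationary {A : Type u} (B : Bandit.{u, v} A) : Prop :=
  ∀ (T : ℕ) (a : Fin T → A) (t t' : Fin T → ℕ), Function.Injective t → Function.Injective t' →
    IdentDistrib (fun ω (k : Fin T) => B.R (t k) ω (a k))
      (fun ω (k : Fin T) => B.R (t' k) ω (a k)) B.P B.P

/-- Let `e` enumerate the actions as `a_1, …, a_m`, with `m = |A|` (so `a_{k+1} = e k`). A stationary
bandit is strongly stationary if, for all `T ≥ 1`, the sequence of reward vectors at timesteps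
`1, …, T` and the sequence, for `n = 1, …, T`, of the vectors with `a_k`-th entry
`R_{n m + k, a_k}` are equal in distribution. -/
def IsStronglyStationary {A : Type u} [Fintype A] (e : Fin (Fintype.card A) ≃ A)
    (B : Bandit.{u, v} A) : Prop :=
  B.IsStationary ∧ ∀ T : ℕ, 1 ≤ T →
    IdentDistrib (fun ω (t : Fin T) => B.R t ω)
      (fun ω (n : Fin T) (a : A) =>
        B.R (((n : ℕ) + 1) * Fintype.card A + (e.symm a : ℕ)) ω a) B.P B.P

end Bandit

/-! The law of a history is a sum over action sequences `a`: the law of the rewards met along `a`,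
weighted by the probability that the policy picks `a` given those rewards (`lintegral_historyLaw`).
The weight does not involve the bandit. So equivalence depends only on the joint laws of rewards
with one action per timestep, and open-loop policies recover all of these.

A stationary bandit does not change these laws when timesteps are moved injectively, hence is
equivalent to its interleaving, where even the entries of one reward vector come from distinct
timesteps. Conversely, strong stationarity turns the joint law of whole vectors into a law of
rewards at distinct timesteps, which equivalence determines. -/

/-- The probability that the policy `π` picks the actions of a history, given its rewards. -/
noncomputable def Policy.prob {A : Type u} [MeasurableSpace A] (π : Policy A) :
    (t : ℕ) → History A t → ENNReal
  | 0, _ => 1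
  | t + 1, h => π.prob t (Fin.init h) * π.act t (Fin.init h) {(h (Fin.last t)).1}

/-- The policy that executes the action `s t` at time `t`, whatever the history. -/
noncomputable def Policy.openLoop {A : Type u} [MeasurableSpace A] (s : ℕ → A) : Policy A where
  act t := Kernel.const _ (Measure.dirac (s t))
  isMarkov _ := inferInstance

/-- The history with actions `a` and rewards `r`. -/
def History.mk {A : Type u} {t : ℕ} (a : Fin t → A) (r : Fin t → ℝ) : History A t :=
  fun i => (a i, r i)

theorem History.measurable_mk {A : Type u} [MeasurableSpace A] {t : ℕ} (a : Fin t → A) :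
    Measurable (History.mk a) := by
  unfold History.mk
  fun_prop

theorem Policy.measurable_prob_mk {A : Type u} [MeasurableSpace A] [DiscreteMeasurableSpace A]
    (π : Policy A) {t : ℕ} (a : Fin t → A) :
    Measurable (fun r : Fin t → ℝ => π.prob t (History.mk a r)) := by
  induction t with
  | zero => exact measurable_const
  | succ t ih =>
    have hinit : Measurable (fun r : Fin (t + 1) → ℝ => (Fin.init r : Fin t → ℝ)) := by
      unfold Fin.init
      fun_prop
    exact ((ih (Fin.init a)).comp hinit).mul
      (((π.act t).measurable_coe (measurableSet_singleton (a (Fin.last t)))).comp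
        ((History.measurable_mk (Fin.init a)).comp hinit))

theorem Policy.prob_openLoop_mk {A : Type u} [MeasurableSpace A] [DiscreteMeasurableSpace A]
    (s : ℕ → A) {t : ℕ} (a : Fin t → A) (r : Fin t → ℝ) [Decidable (a = fun i : Fin t => s i)] :
    (Policy.openLoop s).prob t (History.mk a r) = if a = (fun i : Fin t => s i) then 1 else 0 := by
  classical
  induction t with
  | zero => simp [Policy.prob, Subsingleton.elim a (fun i : Fin 0 => s i)]
  | succ t ih =>
    have hinit : (Fin.init (History.mk a r) : History A t) =
        History.mk (Fin.init a) (Fin.init r) := rfl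
    have key : a = (fun i : Fin (t + 1) => s i) ↔ Fin.init a = (fun i : Fin t => s i) ∧ a (Fin.last t) = s t := by
      simp [funext_iff, Fin.forall_fin_succ', Fin.init]
    rw [Policy.prob, hinit, ih]
    by_cases h1 : Fin.init a = (fun i : Fin t => s i) <;> by_cases h2 : a (Fin.last t) = s t <;>
      simp [key, h1, h2, Policy.openLoop, History.mk, eq_comm (a := s t)]

/-! ### Histories and equivalence -/

namespace Bandit

/-- The rewards of the actions `a` at the timesteps `t`. -/
def rewards {A : Type u} (B : Bandit.{u, v} A) {ι : Type*} (a : ι → A) (t : ι → ℕ) (ω : B.Ω) :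
    ι → ℝ :=
  fun i => B.R (t i) ω (a i)

theorem measurable_rewards {A : Type u} (B : Bandit.{u, v} A) {ι : Type*} (a : ι → A)
    (t : ι → ℕ) : Measurable (B.rewards a t) :=
  measurable_pi_lambda _ fun i => (measurable_pi_apply (a i)).comp (B.measurable_R (t i))

section Interaction

variable {A : Type u} [MeasurableSpace A] [Fintype A] [DiscreteMeasurableSpace A]

theorem measurable_interaction_step (B : Bandit.{u, v} A) (t : ℕ) :
    Measurable (fun x : (B.Ω × History A t) × A =>
      (x.1.1, (Fin.snoc x.1.2 (x.2, B.R t x.1.1 x.2) : History A (t + 1)))) := by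
  refine measurable_from_prod_countable_left fun a => ?_
  refine measurable_fst.prodMk (measurable_pi_lambda _ fun i => ?_)
  have hR : Measurable (fun x : B.Ω × History A t => B.R t x.1 a) :=
    (measurable_pi_apply a).comp ((B.measurable_R t).comp measurable_fst)
  refine Fin.lastCases ?_ (fun j => ?_) i
  · simpa using measurable_const.prodMk hR
  · simpa [Function.comp_def] using
      (measurable_pi_apply (X := fun _ : Fin t => A × ℝ) j).comp (measurable_snd (α := B.Ω))

instance isProbabilityMeasure_interactionLaw (B : Bandit.{u, v} A) (π : Policy A) (t : ℕ) :
    IsProbabilityMeasure (B.interactionLaw π t) := by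
  induction t with
  | zero => exact Measure.isProbabilityMeasure_map (measurable_id.prodMk measurable_const).aemeasurable
  | succ t ih =>
    have := π.isMarkov t
    exact Measure.isProbabilityMeasure_map (B.measurable_interaction_step t).aemeasurable

/-- Given `ω`, the actions determine the history. One more step multiplies the weight by the
probability of the new action. -/
theorem lintegral_interactionLaw (B : Bandit.{u, v} A) (π : Policy A) (t : ℕ)
    {f : B.Ω × History A t → ENNReal} (hf : Measurable f) :
    ∫⁻ x, f x ∂(B.interactionLaw π t) =
      ∑ a : Fin t → A, ∫⁻ ω, π.prob t (History.mk a (B.rewards a (↑) ω)) *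
        f (ω, History.mk a (B.rewards a (↑) ω)) ∂B.P := by
  induction t with
  | zero =>
    rw [interactionLaw, lintegral_map hf (measurable_id'.prodMk measurable_const)]
    simp only [Fintype.sum_unique, Policy.prob, one_mul]
    congr! 3
    exact Prod.ext rfl (Subsingleton.elim _ _)
  | succ t ih =>
    have := π.isMarkov t
    have hstep := B.measurable_interaction_step t
    have hx (x : A) : Measurable (fun y : B.Ω × History A t =>
        f (y.1, (Fin.snoc y.2 (x, B.R t y.1 x) : History A (t + 1))) * π.act t y.2 {x}) :=
      (hf.comp (hstep.comp (measurable_id.prodMk measurable_const))).mul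
        (((π.act t).measurable_coe (measurableSet_singleton x)).comp measurable_snd)
    rw [interactionLaw, lintegral_map hf hstep, Measure.lintegral_compProd (by exact hf.comp hstep)]
    simp only [lintegral_fintype, Kernel.prodMkLeft_apply]
    rw [ih (Finset.measurable_sum _ fun x _ => hx x)]
    rw [← (Fin.snocEquiv (fun _ : Fin (t + 1) => A)).sum_comp, Fintype.sum_prod_type_right]
    refine Finset.sum_congr rfl fun a _ => ?_
    have hr : Measurable (fun ω => History.mk a (B.rewards a (↑) ω)) :=
      (History.measurable_mk a).comp (B.measurable_rewards a _)
    simp only [Finset.mul_sum]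
    rw [lintegral_finsetSum _ fun x _ => by
      exact ((π.measurable_prob_mk a).comp (B.measurable_rewards a _)).mul
        ((hx x).comp (measurable_id.prodMk hr))]
    refine Finset.sum_congr rfl fun x _ => lintegral_congr fun ω => ?_
    have hsnoc : History.mk (Fin.snoc a x : Fin (t + 1) → A)
          (B.rewards (Fin.snoc a x : Fin (t + 1) → A) (↑) ω) =
        Fin.snoc (History.mk a (B.rewards a (↑) ω)) (x, B.R t ω x) := by
      funext i
      refine Fin.lastCases ?_ (fun j => ?_) i <;> simp [History.mk, rewards]
    simp only [Fin.snocEquiv, Equiv.coe_fn_mk]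
    rw [hsnoc, Policy.prob, Fin.init_snoc, Fin.snoc_last]
    ring

theorem lintegral_historyLaw (B : Bandit.{u, v} A) (π : Policy A) (t : ℕ)
    {f : History A t → ENNReal} (hf : Measurable f) :
    ∫⁻ h, f h ∂(B.historyLaw π t) =
      ∑ a : Fin t → A, ∫⁻ r, π.prob t (History.mk a r) * f (History.mk a r)
        ∂(B.P.map (B.rewards a (↑))) := by
  rw [historyLaw, lintegral_map hf measurable_snd,
    B.lintegral_interactionLaw π t (f := fun x => f x.2) (hf.comp measurable_snd)]
  refine Finset.sum_congr rfl fun a _ => ?_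
  exact (lintegral_map ((π.measurable_prob_mk a).mul (hf.comp (History.measurable_mk a)))
    (B.measurable_rewards a _)).symm

theorem equivalent_of_map_rewards_eq {B B' : Bandit.{u, v} A}
    (h : ∀ (T : ℕ) (a : Fin T → A), B.P.map (B.rewards a (↑)) = B'.P.map (B'.rewards a (↑))) :
    B.Equivalent B' := by
  refine fun π T => Measure.ext_of_lintegral _ fun f hf => ?_
  simp only [lintegral_historyLaw _ π T hf, h]

theorem historyLaw_openLoop (B : Bandit.{u, v} A) (s : ℕ → A) (T : ℕ) :
    B.historyLaw (Policy.openLoop s) T =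
      (B.P.map (B.rewards (fun i : Fin T => s i) (↑))).map (History.mk fun i => s i) := by
  classical
  refine Measure.ext_of_lintegral _ fun f hf => ?_
  rw [lintegral_historyLaw _ _ _ hf, lintegral_map hf (History.measurable_mk _),
    Finset.sum_eq_single (fun i : Fin T => s i)]
  · simp [Policy.prob_openLoop_mk]
  · intro a _ ha
    simp [Policy.prob_openLoop_mk, ha]
  · simp

theorem Equivalent.map_rewards_eq {B B' : Bandit.{u, v} A} (h : B.Equivalent B')
    {ι : Type*} [Finite ι] (a : ι → A) {t : ι → ℕ} (ht : Function.Injective t) :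
    B.P.map (B.rewards a t) = B'.P.map (B'.rewards a t) := by
  -- If `ι` is empty, `A` may be empty too, and then there is no open-loop policy.
  cases isEmpty_or_nonempty ι with
  | inl _ =>
    have hB (C : Bandit.{u, v} A) : C.P.map (C.rewards a t) = Measure.dirac isEmptyElim := by
      have hc : C.rewards a t = fun _ => isEmptyElim := by
        funext ω i
        exact isEmptyElim i
      rw [hc, Measure.map_const, measure_univ, one_smul]
    rw [hB, hB]
  | inr _ =>
    obtain ⟨N, hN⟩ := (Set.finite_range t).bddAbove
    have hlt (i : ι) : t i < N + 1 := Nat.lt_succ_of_le (hN ⟨i, rfl⟩)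
    -- Play `a i` at time `t i`; elsewhere the action is arbitrary, and `g` discards its reward.
    -- Injectivity of `t` rules out conflicting demands.
    let s : ℕ → A := fun n => a (Function.invFun t n)
    let g : History A (N + 1) → ι → ℝ := fun x i => (x ⟨t i, hlt i⟩).2
    have hg : Measurable g := by fun_prop
    have hB (C : Bandit.{u, v} A) :
        (C.historyLaw (Policy.openLoop s) (N + 1)).map g = C.P.map (C.rewards a t) := by
      rw [historyLaw_openLoop, Measure.map_map hg (History.measurable_mk _),
        Measure.map_map (hg.comp (History.measurable_mk _)) (C.measurable_rewards _ _)]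
      congr 1
      funext ω i
      simp [g, s, History.mk, rewards, Function.leftInverse_invFun ht i]
    rw [← hB B, ← hB B', h]

end Interaction

/-! ### Stationarity and interleaving -/

theorem IsStationary.map_rewards_eq {A : Type u} {B : Bandit.{u, v} A} (h : B.IsStationary)
    {ι : Type*} [Finite ι] (a : ι → A) {t t' : ι → ℕ} (ht : Function.Injective t)
    (ht' : Function.Injective t') :
    B.P.map (B.rewards a t) = B.P.map (B.rewards a t') := by
  let σ := Finite.equivFin ι
  have hr : Measurable (fun (r : Fin (Nat.card ι) → ℝ) (i : ι) => r (σ i)) := by fun_prop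
  have key := ((h _ (a ∘ σ.symm) (t ∘ σ.symm) (t' ∘ σ.symm) (ht.comp σ.symm.injective)
    (ht'.comp σ.symm.injective)).comp hr).map_eq
  simp only [Function.comp_def, Equiv.symm_apply_apply] at key
  exact key

theorem isStationary_of_map_rewards_eq {A : Type u} {B : Bandit.{u, v} A}
    (h : ∀ (T : ℕ) (a : Fin T → A) (t t' : Fin T → ℕ), Function.Injective t →
      Function.Injective t' → B.P.map (B.rewards a t) = B.P.map (B.rewards a t')) :
    B.IsStationary :=
  fun T a t t' ht ht' =>
    ⟨(B.measurable_rewards a t).aemeasurable, (B.measurable_rewards a t').aemeasurable,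
      h T a t t' ht ht'⟩

/-- Division with remainder by `Fintype.card A` recovers `n i` and the index of `a i`. -/
theorem injective_mul_add {ι A : Type*} [Fintype A] (e : Fin (Fintype.card A) ≃ A) {n : ι → ℕ}
    {a : ι → A} (h : Function.Injective fun i => (n i, a i)) :
    Function.Injective fun i => n i * Fintype.card A + (e.symm (a i) : ℕ) := by
  intro i j hij
  have hi := (e.symm (a i)).isLt
  have hj := (e.symm (a j)).isLt
  have hm : 0 < Fintype.card A := by omega
  dsimp only at hij
  have hdiv := congrArg (· / Fintype.card A) hij
  have hmod := congrArg (· % Fintype.card A) hij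
  simp only [mul_comm _ (Fintype.card A), Nat.mul_add_div hm, Nat.div_eq_of_lt hi,
    Nat.div_eq_of_lt hj, Nat.mul_add_mod, Nat.mod_eq_of_lt hi, Nat.mod_eq_of_lt hj,
    add_zero] at hdiv hmod
  exact h (Prod.ext hdiv (e.symm.injective (Fin.ext hmod)))

/-- The bandit with reward vectors `(R_{nm+1,a_1}, …, R_{nm+m,a_m})`. -/
def interleave {A : Type u} [Fintype A] (e : Fin (Fintype.card A) ≃ A) (B : Bandit.{u, v} A) :
    Bandit.{u, v} A where
  Ω := B.Ω
  P := B.P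
  R n ω a := B.R (n * Fintype.card A + (e.symm a : ℕ)) ω a
  measurable_R n := B.measurable_rewards (fun a => a) (fun a => n * Fintype.card A + (e.symm a : ℕ))

theorem IsStationary.isStronglyStationary_interleave {A : Type u} [Fintype A]
    (e : Fin (Fintype.card A) ≃ A) {B : Bandit.{u, v} A} (h : B.IsStationary) :
    (B.interleave e).IsStronglyStationary e := by
  refine ⟨isStationary_of_map_rewards_eq fun T a t t' ht ht' => h.map_rewards_eq a
    (injective_mul_add e fun i j hij => ht (Prod.ext_iff.1 hij).1)
    (injective_mul_add e fun i j hij => ht' (Prod.ext_iff.1 hij).1), fun T _ => ?_⟩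
  have hcurry : Measurable (fun (r : Fin T × A → ℝ) (n : Fin T) (a : A) => r (n, a)) := by fun_prop
  have hfst : Function.Injective fun x : Fin T × A =>
      (x.1 : ℕ) * Fintype.card A + (e.symm x.2 : ℕ) :=
    injective_mul_add e fun x y hxy =>
      Prod.ext (Fin.ext (Prod.ext_iff.1 hxy).1) (Prod.ext_iff.1 hxy).2
  -- The blocks in the definition of strong stationarity are read off a bandit that is already
  -- interleaved, so the index map is applied twice.
  have hsnd : Function.Injective fun x : Fin T × A =>
      (((x.1 : ℕ) + 1) * Fintype.card A + (e.symm x.2 : ℕ)) * Fintype.card A +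
        (e.symm x.2 : ℕ) :=
    injective_mul_add e fun x y hxy => injective_mul_add (n := fun x : Fin T × A => (x.1 : ℕ) + 1)
      (a := Prod.snd) e (fun x y hxy => Prod.ext
        (Fin.ext (Nat.succ_injective (Prod.ext_iff.1 hxy).1)) (Prod.ext_iff.1 hxy).2)
      (Prod.ext_iff.1 hxy).1
  exact IdentDistrib.comp ⟨(B.measurable_rewards _ _).aemeasurable,
    (B.measurable_rewards _ _).aemeasurable, h.map_rewards_eq Prod.snd hfst hsnd⟩ hcurry

theorem IsStationary.equivalent_interleave {A : Type u} [Fintype A] [MeasurableSpace A]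
    [DiscreteMeasurableSpace A] (e : Fin (Fintype.card A) ≃ A) {B : Bandit.{u, v} A}
    (h : B.IsStationary) : B.Equivalent (B.interleave e) :=
  equivalent_of_map_rewards_eq fun _ a => h.map_rewards_eq a Fin.val_injective
    (injective_mul_add e fun _ _ hij => Fin.ext (Prod.ext_iff.1 hij).1)

theorem IsStationary.of_equivalent {A : Type u} [Fintype A] [MeasurableSpace A]
    [DiscreteMeasurableSpace A] {B B' : Bandit.{u, v} A} (h : B'.IsStationary)
    (hB : B.Equivalent B') : B.IsStationary :=
  isStationary_of_map_rewards_eq fun _ a t t' ht ht' => by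
    rw [hB.map_rewards_eq a ht, hB.map_rewards_eq a ht', h.map_rewards_eq a ht ht']

theorem equivalent_of_identDistrib {A : Type u} [Fintype A] [MeasurableSpace A]
    [DiscreteMeasurableSpace A] {B B' : Bandit.{u, v} A}
    (h : ∀ T : ℕ, 1 ≤ T → IdentDistrib (fun ω (t : Fin T) => B.R t ω)
      (fun ω (t : Fin T) => B'.R t ω) B.P B'.P) : B.Equivalent B' := by
  refine equivalent_of_map_rewards_eq fun T a => ?_
  have hr : Measurable (fun (x : Fin (T + 1) → A → ℝ) (i : Fin T) => x i.castSucc (a i)) := by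
    fun_prop
  -- The hypothesis starts at length 1; `T + 1` also covers `T = 0`.
  exact ((h (T + 1) (Nat.le_add_left 1 T)).comp hr).map_eq

theorem IsStronglyStationary.identDistrib_of_equivalent {A : Type u} [Fintype A]
    [MeasurableSpace A] [DiscreteMeasurableSpace A] {e : Fin (Fintype.card A) ≃ A}
    {B B' : Bandit.{u, v} A} (hB : B.IsStronglyStationary e) (hB' : B'.IsStronglyStationary e)
    (h : B.Equivalent B') (T : ℕ) (hT : 1 ≤ T) :
    IdentDistrib (fun ω (t : Fin T) => B.R t ω) (fun ω (t : Fin T) => B'.R t ω) B.P B'.P := by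
  -- Both sides become rewards at distinct timesteps, one action each, which an open-loop policy can
  -- observe.
  refine ((hB.2 T hT).trans ?_).trans (hB'.2 T hT).symm
  have hcurry : Measurable (fun (r : Fin T × A → ℝ) (n : Fin T) (a : A) => r (n, a)) := by fun_prop
  have hinj : Function.Injective fun x : Fin T × A =>
      ((x.1 : ℕ) + 1) * Fintype.card A + (e.symm x.2 : ℕ) :=
    injective_mul_add e fun x y hxy => Prod.ext
      (Fin.ext (Nat.succ_injective (Prod.ext_iff.1 hxy).1)) (Prod.ext_iff.1 hxy).2
  exact IdentDistrib.comp ⟨(B.measurable_rewards _ _).aemeasurable,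
    (B'.measurable_rewards _ _).aemeasurable, h.map_rewards_eq Prod.snd hinj⟩ hcurry

end Bandit

theorem theorem5 {A : Type u} [Fintype A] [MeasurableSpace A] [DiscreteMeasurableSpace A]
    (e : Fin (Fintype.card A) ≃ A) :
    (∀ B : Bandit.{u, v} A,
      B.IsStationary ↔ ∃ B' : Bandit.{u, v} A, B'.IsStronglyStationary e ∧ B.Equivalent B') ∧
    (∀ B B' : Bandit.{u, v} A, B.IsStronglyStationary e → B'.IsStronglyStationary e →
      (B.Equivalent B' ↔ ∀ T : ℕ, 1 ≤ T →
        IdentDistrib (fun ω (t : Fin T) => B.R t ω) (fun ω (t : Fin T) => B'.R t ω) B.P B'.P)) := by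
  refine ⟨fun B => ⟨fun h => ⟨B.interleave e, h.isStronglyStationary_interleave e,
    h.equivalent_interleave e⟩, ?_⟩, fun B B' hB hB' => ⟨?_, ?_⟩⟩
  · rintro ⟨B', hB', h⟩
    exact hB'.1.of_equivalent h
  · exact hB.identDistrib_of_equivalent hB'
  · exact Bandit.equivalent_of_identDistrib
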